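/- Formulas of the (closed) reflection calculus $\mathsf{RC}$ are built from $\top$ by $\phi\wedge\psi$ and $\langle\lambda\rangle\phi$ (also written $\lambda\phi$), where $\lambda$ is any ordinal. $\mathsf{RC}$ derives sequents $\phi\Rightarrow\psi$ by the axioms $\phi\Rightarrow\phi$, $\phi\Rightarrow\top$, $\phi\wedge\psi\Rightarrow\phi$, $\phi\wedge\psi\Rightarrow\psi$, $\lambda\lambda\phi\Rightarrow\lambda\phi$, $\lambda\phi\Rightarrow\mu\phi$ for $\mu\le\lambda$, $\lambda\phi\wedge\mu\psi\Rightarrow\lambda(\phi\wedge\mu\psi)$ for $\mu<\lambda$, and the rules: from $\phi\Rightarrow\psi$ and $\psi\Rightarrow\theta$ infer $\phi\Rightarrow\theta$; from $\phi\Rightarrow\psi$ and $\phi\Rightarrow\theta$ infer $\phi\Rightarrow\psi\wedge\theta$; from $\phi\Rightarrow\psi$ infer $\lambda\phi\Rightarrow\lambda\psi$. A worm is a formula $\lambda_1\cdots\lambda_n\top$ with $n\ge 0$ and ordinals $\lambda_i$. If $\mathfrak v=\lambda_1\cdots\lambda_n\top$ and $\mathfrak w=\mu_1\cdots\mu_m\top$,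 then $\mathfrak v\,0\,\mathfrak w=\lambda_1\cdots\lambda_n\,0\,\mu_1\cdots\mu_m\top$, and $\alpha\uparrow\mathfrak w=\langle\alpha+\mu_1\rangle\cdots\langle\alpha+\mu_m\rangle\top$. Write $\mathfrak v\trianglelefteq\mathfrak w$ if $\mathsf{RC}$ derives $\mathfrak w\Rightarrow\langle 0\rangle\mathfrak v$, or if it derives both $\mathfrak v\Rightarrow\mathfrak w$ and $\mathfrak w\Rightarrow\mathfrak v$; write $\mathfrak v\prec\mathfrak w$ if $\mathfrak v\trianglelefteq\mathfrak w$ and not $\mathfrak w\trianglelefteq\mathfrak v$. The order-type function $o$ from worms to ordinals is given by $o(\mathfrak w)=\sup_{\mathfrak v\prec\mathfrak w}(o(\mathfrak v)+1)$. The hyperexponentials $\langle e^\xi\rangle_{\xi\in\mathsf{Ord}}$ are the hyperation of $e(\xi)=-1+\omega^\xi$ (left subtraction), i.e. the pointwise least among all families $\langle g^\xi\rangle_{\xi\in\mathsf{Ord}}$ of normal functions on the ordinals such that $g^1=e$ and $g^{\alpha+\beta}=g^\alpha\circ g^\beta$ for all ordinals $\alpha,\beta$. Theorem. The function $o$ and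 the family $\langle e^\xi\rangle_{\xi\in\mathsf{Ord}}$ are well defined: each exists and is unique. For all worms $\mathfrak v,\mathfrak w$ and every ordinal $\alpha$: (1) $o(\top)=0$; (2) $o(\mathfrak v\,0\,\mathfrak w)=o(\mathfrak w)+1+o(\mathfrak v)$; (3) $o(\alpha\uparrow\mathfrak w)=e^\alpha(o(\mathfrak w))$. -/

import Mathlib

open scoped Ordinal

universe u

/-- Closed formulas of the reflection calculus `RC`, with one modality for each ordinal. -/
inductive RCFormula : Type (u + 1) where
  | top : RCFormula
  | and (φ ψ : RCFormula) : RCFormula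
  | dia (lam : Ordinal.{u}) (φ : RCFormula) : RCFormula

namespace RCFormula

/-- `Derives φ ψ` says that the sequent `φ ⇒ ψ` is derivable in `RC`. -/
inductive Derives : RCFormula.{u} → RCFormula.{u} → Prop where
  | refl (φ : RCFormula) : Derives φ φ
  | toTop (φ : RCFormula) : Derives φ top
  | trans {φ ψ θ : RCFormula} : Derives φ ψ → Derives ψ θ → Derives φ θ
  | andLeft (φ ψ : RCFormula) : Derives (and φ ψ) φ
  | andRight (φ ψ : RCFormula) : Derives (and φ ψ) ψ
  | andIntro {φ ψ θ : RCFormula} : Derives φ ψ → Derives φ θ → Derives φ (and ψ θ)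
  | diaDia (lam : Ordinal) (φ : RCFormula) : Derives (dia lam (dia lam φ)) (dia lam φ)
  | diaMono (lam : Ordinal) {φ ψ : RCFormula} : Derives φ ψ → Derives (dia lam φ) (dia lam ψ)
  | diaLower {mu lam : Ordinal} (φ : RCFormula) : mu ≤ lam → Derives (dia lam φ) (dia mu φ)
  | diaAnd {mu lam : Ordinal} (φ ψ : RCFormula) : mu < lam →
      Derives (and (dia lam φ) (dia mu ψ)) (dia lam (and φ (dia mu ψ)))

/-- Provable equivalence `φ ≡ ψ` in `RC`. -/
def Equivalent (φ ψ : RCFormula.{u}) : Prop := Derives φ ψ ∧ Derives ψ φ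

/-- The promotion `α ↑ φ`: every ordinal `ξ` occurring in `φ` is replaced by `α + ξ`. -/
noncomputable def promote (α : Ordinal.{u}) : RCFormula.{u} → RCFormula.{u}
  | top => top
  | and φ ψ => and (promote α φ) (promote α ψ)
  | dia lam φ => dia (α + lam) (promote α φ)

end RCFormula

/-- A worm `λ₁ … λₙ ⊤`, given by the finite list `[λ₁, …, λₙ]` of its entries; the empty list is
the worm `⊤`. For worms `v` and `w`, the worm `v 0 w` is the list `v ++ 0 :: w`. -/
abbrev Worm : Type (u + 1) := List Ordinal.{u}

namespace Worm

/-- The formula `λ₁ … λₙ ⊤` of `RC` that the list stands for. -/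
def toFormula : Worm.{u} → RCFormula.{u}
  | [] => RCFormula.top
  | lam :: w => RCFormula.dia lam (toFormula w)

theorem toFormula_injective : Function.Injective toFormula.{u} := by
  intro v
  induction v with
  | nil => intro w h; cases w with
    | nil => rfl
    | cons b w => simp [toFormula] at h
  | cons a v ih => intro w h; cases w with
    | nil => simp [toFormula] at h
    | cons b w =>
      simp only [toFormula, RCFormula.dia.injEq] at h
      rw [h.1, ih h.2]

/-- The promotion `α ↑ w` of a worm. -/
noncomputable def promote (α : Ordinal.{u}) (w : Worm.{u}) : Worm.{u} := w.map (fun ξ => α + ξ)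

/-- Promotion of worms is the restriction of promotion of formulas. -/
theorem toFormula_promote (α : Ordinal.{u}) (w : Worm.{u}) :
    toFormula (promote α w) = RCFormula.promote α (toFormula w) := by
  induction w with
  | nil => rfl
  | cons a w ih => exact congrArg (RCFormula.dia (α + a)) ih

/-- The consistency order at level `mu`: `v` is below `w` if `RC` derives `w ⇒ ⟨mu⟩ v`. -/
def ConsLT (mu : Ordinal.{u}) (v w : Worm.{u}) : Prop :=
  RCFormula.Derives (toFormula w) (RCFormula.dia mu (toFormula v))

/-- The preorder of worms by consistency strength at level `mu`. -/
def ConsLE (mu : Ordinal.{u}) (v w : Worm.{u}) : Prop :=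
  ConsLT mu v w ∨ RCFormula.Equivalent (toFormula v) (toFormula w)

end Worm

/-- `o` is the order-type function of the preorder `le` on `A`:
`o a = ⋃_{b ≺ a} (o b + 1)` for all `a`, where `b ≺ a` means that `le b a` and not `le a b`. -/
def IsOrderTypeFunction {A : Type*} (le : A → A → Prop) (o : A → Ordinal.{u}) : Prop :=
  ∀ a, IsLUB {ξ | ∃ b, le b a ∧ ¬ le a b ∧ ξ = o b + 1} (o a)

/-- `g` is a family of normal functions with `g^1 = f` and `g^(α + β) = g^α ∘ g^β`. -/
structure IsWeakHyperation (f : Ordinal.{u} → Ordinal.{u})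
    (g : Ordinal.{u} → Ordinal.{u} → Ordinal.{u}) : Prop where
  normal : ∀ α, Order.IsNormal (g α)
  one : g 1 = f
  add : ∀ α β, g (α + β) = g α ∘ g β

/-- `g` is the hyperation of `f`: the pointwise minimal weak hyperation. -/
def IsHyperation (f : Ordinal.{u} → Ordinal.{u})
    (g : Ordinal.{u} → Ordinal.{u} → Ordinal.{u}) : Prop :=
  IsWeakHyperation f g ∧ ∀ g', IsWeakHyperation f g' → ∀ α ξ, g α ξ ≤ g' α ξ

/-- The function `ξ ↦ -1 + ω ^ ξ`. Subtraction of ordinals is left subtraction: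
`1 + (ω ^ ξ - 1) = ω ^ ξ`. -/
noncomputable def expFun (ξ : Ordinal.{u}) : Ordinal.{u} := ω ^ ξ - 1

theorem one_add_expFun (ξ : Ordinal.{u}) : 1 + expFun ξ = ω ^ ξ :=
  Ordinal.add_sub_cancel_of_le (Order.one_le_iff_pos.2 (Ordinal.opow_pos ξ Ordinal.omega0_pos))

/-!
The proof computes `o` instead of analysing its recursion. The explicit function `Worm.wormOrd` is
defined by recursion on the length of a worm through the equations of the theorem: a nonempty worm is
`μ ↑ (v 0 u)`, with `μ` its least entry and no `0` in `v`, and its ordinal is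
`e ^ μ (o u + 1 + o v)`. Two facts show that it is the order-type function: it represents the
preorder (`Worm.consLE_zero_iff`), and it takes every ordinal as a value
(`Worm.wormOrd_surjective`), so that no gaps shift the order types.

The hyperexponentials come from the Veblen hierarchy. The family `hyper f` sends
`ω ^ γ₁ + ⋯ + ω ^ γₙ` in Cantor normal form to the composition of the Veblen functions over `f` of
indices `γ₁, …, γₙ`. Additivity holds because terms absorbed in an ordinal sum belong to Veblen
functions that fix the values of the later ones. Minimality holds because in any weak hyperation `g`
the values of `g (ω ^ γ)` are common fixed points of the earlier functions, and the Veblen function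
enumerates these without omission. Surjectivity of `wormOrd` follows: an ordinal `ξ` either
splits as `a + 1 + b`, or `1 + ξ` is a power of `ω`, and then `ξ` is a value of a Veblen function at a
smaller argument, since some Veblen function moves it.

That `o v < o w` implies `w ⇒ 0 v`, and `o v = o w` implies `w ⇒ v`, is proved by induction on the
total length (`Worm.complete`). Since `v 0 u` is equivalent to `v ∧ 0 u` when `0` is not in `v`, and
`1 + o (v 0 u) = 1 + o u + ω ^ o v'` for `v = 1 ↑ v'`, the comparison reduces to the last terms of
Cantor normal forms, that is, to shorter worms. By linearity the converse only needs irreflexivity: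
no `φ` derives `⟨λ⟩φ`. As a derivation mentions finitely many ordinals, natural numbers suffice as
levels, and there Ignatiev's model refutes it: its points are sequences of ordinals, each at most the
last Cantor exponent of the one before, the truth set of each formula has a least point
(`RCFormula.exists_forces_iff_aboveAxis`), and every modality leads to points with a smaller
coordinate.
-/

/-! ### Ordinal arithmetic -/

theorem expFun_strictMono : StrictMono expFun.{u} := fun a b h => by
  rw [← add_lt_add_iff_left 1, one_add_expFun, one_add_expFun]
  exact (Ordinal.opow_lt_opow_iff_right Ordinal.one_lt_omega0).2 h

theorem isNormal_expFun : Order.IsNormal expFun.{u} := by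
  refine Order.isNormal_iff.2 ⟨expFun_strictMono, fun l hl b hb => ?_⟩
  have hn := Ordinal.isNormal_opow Ordinal.one_lt_omega0
  rw [← add_le_add_iff_left 1, one_add_expFun]
  refine (hn.le_iff_forall_le hl).2 fun a ha => ?_
  rw [← one_add_expFun]
  exact add_le_add_right (hb a ha) 1

theorem expFun_zero : expFun.{u} 0 = 0 := by simp [expFun]

theorem one_lt_expFun_one : 1 < expFun.{u} 1 := by
  rw [← add_lt_add_iff_left 1, one_add_expFun, Ordinal.opow_one]
  exact_mod_cast Ordinal.natCast_lt_omega0 2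

/-- Below `b + ω ^ y` there is room for adding any power of `ω` up to `ω ^ y`. This is what makes
the last term of a Cantor normal form decide comparisons. -/
theorem add_opow_le_add_opow {a b x y : Ordinal.{u}} (hxy : x ≤ y) (h : a < b + ω ^ y) :
    a + ω ^ x ≤ b + ω ^ y := by
  have h1 : a + ω ^ x ≤ a + ω ^ y :=
    add_le_add_right (Ordinal.opow_le_opow_right Ordinal.omega0_pos hxy) a
  refine h1.trans ?_
  rcases le_total a b with hab | hab
  · exact add_le_add_left hab _
  · have ha := Ordinal.add_sub_cancel_of_le hab
    rw [← ha] at h ⊢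
    rw [add_assoc, Ordinal.add_omega0_opow (lt_of_add_lt_add_left h)]

theorem lt_of_add_opow_lt_add_opow {a b x y : Ordinal.{u}} (h : a < b + ω ^ y)
    (h' : b + ω ^ y < a + ω ^ x) : y < x := by
  by_contra hxy
  exact (add_opow_le_add_opow (not_lt.1 hxy) h).not_gt h'

theorem eq_of_add_opow_eq_add_opow {a b x y : Ordinal.{u}} (h : a + ω ^ x = b + ω ^ y) : x = y := by
  have key : ∀ {a b x y : Ordinal.{u}}, a + ω ^ x = b + ω ^ y → x ≤ y → x = y := by
    intro a b x y h hxy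
    by_contra hne
    have h1 : a < b + ω ^ y := h ▸ lt_add_of_pos_right a (Ordinal.opow_pos x Ordinal.omega0_pos)
    have h2 := add_opow_le_add_opow le_rfl h1
    rw [← h] at h2
    have h3 := (Ordinal.opow_lt_opow_iff_right Ordinal.one_lt_omega0).2 (lt_of_le_of_ne hxy hne)
    exact ((add_lt_add_iff_left a).2 h3).not_ge h2
  rcases le_total x y with hxy | hxy
  · exact key h hxy
  · exact (key h.symm hxy).symm

/-! ### Hyperation by the Veblen hierarchy -/

/-- The hyperation of `f`: if `β = ω ^ γ₁ + ⋯ + ω ^ γₙ` is in Cantor normal form, then `hyper f β`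
is the composition of the Veblen functions over `f` of the indices `γ₁, …, γₙ`. -/
noncomputable def hyper (f : Ordinal.{u} → Ordinal.{u}) (β : Ordinal.{u}) :
    Ordinal.{u} → Ordinal.{u} :=
  if _h : β = 0 then id
  else Ordinal.veblenWith f (Ordinal.log ω β) ∘ hyper f (β - ω ^ Ordinal.log ω β)
termination_by β
decreasing_by exact Ordinal.sub_omega0_opow_log_lt _h

section Hyper

variable {f : Ordinal.{u} → Ordinal.{u}}

theorem hyper_zero (f : Ordinal.{u} → Ordinal.{u}) : hyper f 0 = id := by
  rw [hyper, dif_pos rfl]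

theorem hyper_of_ne_zero (f : Ordinal.{u} → Ordinal.{u}) {β : Ordinal.{u}} (h : β ≠ 0) :
    hyper f β = Ordinal.veblenWith f (Ordinal.log ω β) ∘ hyper f (β - ω ^ Ordinal.log ω β) := by
  rw [hyper, dif_neg h]

theorem hyper_opow (f : Ordinal.{u} → Ordinal.{u}) (γ : Ordinal.{u}) :
    hyper f (ω ^ γ) = Ordinal.veblenWith f γ := by
  rw [hyper_of_ne_zero f (Ordinal.opow_pos γ Ordinal.omega0_pos).ne',
    Ordinal.log_opow Ordinal.one_lt_omega0, Ordinal.sub_self, hyper_zero]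
  rfl

/-- Induction along the Cantor normal form, from the right. -/
theorem cnf_induction {p : Ordinal.{u} → Prop} (zero : p 0)
    (add : ∀ γ β : Ordinal.{u}, p β → p (ω ^ γ + β)) (β : Ordinal.{u}) : p β := by
  induction β using WellFoundedLT.induction with
  | ind β ih =>
    by_cases h : β = 0
    · exact h ▸ zero
    · rw [← Ordinal.add_sub_cancel_of_le (Ordinal.opow_log_le_self ω h)]
      exact add _ _ (ih _ (Ordinal.sub_omega0_opow_log_lt h))

theorem hyper_normal (hf : Order.IsNormal f) (β : Ordinal.{u}) : Order.IsNormal (hyper f β) := by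
  induction β using WellFoundedLT.induction with
  | ind β ih =>
    by_cases h : β = 0
    · rw [h, hyper_zero]; exact Order.IsNormal.id
    · rw [hyper_of_ne_zero f h]
      exact (Ordinal.isNormal_veblenWith hf _).comp (ih _ (Ordinal.sub_omega0_opow_log_lt h))

theorem hyper_opow_add (hf : Order.IsNormal f) (γ β : Ordinal.{u}) :
    hyper f (ω ^ γ + β) = Ordinal.veblenWith f γ ∘ hyper f β := by
  by_cases h : β = 0
  · rw [h, add_zero, hyper_opow, hyper_zero]; rfl
  rcases lt_or_ge γ (Ordinal.log ω β) with hlt | hle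
  · have h1 : ω ^ γ + β = β := Ordinal.add_of_omega0_opow_le
      ((Ordinal.opow_lt_opow_iff_right Ordinal.one_lt_omega0).2 hlt) (Ordinal.opow_log_le_self ω h)
    rw [h1, hyper_of_ne_zero f h]
    funext x
    exact (Ordinal.veblenWith_veblenWith_of_lt hf hlt _).symm
  · have h0 : ω ^ γ + β ≠ 0 := by simp [h]
    have h1 : Ordinal.log ω (ω ^ γ + β) = γ := by
      refine (Ordinal.log_eq_iff Ordinal.one_lt_omega0 h0 γ).2 ⟨le_self_add, ?_⟩
      have hβ : β < ω ^ (γ + 1) := Ordinal.lt_opow_of_log_lt Ordinal.one_lt_omega0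
        (lt_of_le_of_lt hle (Order.lt_add_one_iff.2 le_rfl))
      exact Ordinal.isPrincipal_add_omega0_opow (γ + 1)
        ((Ordinal.opow_lt_opow_iff_right Ordinal.one_lt_omega0).2
          (Order.lt_add_one_iff.2 le_rfl)) hβ
    rw [hyper_of_ne_zero f h0, h1, Ordinal.add_sub_cancel]

theorem hyper_add (hf : Order.IsNormal f) (α β : Ordinal.{u}) :
    hyper f (α + β) = hyper f α ∘ hyper f β := by
  induction α using cnf_induction with
  | zero => rw [zero_add, hyper_zero]; rfl
  | add γ α ih => rw [add_assoc, hyper_opow_add hf, ih, hyper_opow_add hf]; rfl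

theorem hyper_one (f : Ordinal.{u} → Ordinal.{u}) : hyper f 1 = f := by
  rw [← Ordinal.opow_zero ω, hyper_opow, Ordinal.veblenWith_zero]

theorem isWeakHyperation_hyper (hf : Order.IsNormal f) : IsWeakHyperation f (hyper f) :=
  ⟨hyper_normal hf, hyper_one f, hyper_add hf⟩

theorem IsWeakHyperation.zero {g : Ordinal.{u} → Ordinal.{u} → Ordinal.{u}}
    (hg : IsWeakHyperation f g) : g 0 = id := by
  funext x
  have h := congrFun (hg.add 0 0) x
  rw [add_zero] at h
  exact ((hg.normal 0).strictMono.injective h).symm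

/-- In a weak hyperation `g`, the values of `g (ω ^ γ)` are fixed by `g (ω ^ δ)` for `δ < γ`, hence
by the smaller Veblen functions; so they lie in the range that the Veblen function enumerates. -/
theorem IsWeakHyperation.veblenWith_le (hf : Order.IsNormal f)
    {g : Ordinal.{u} → Ordinal.{u} → Ordinal.{u}} (hg : IsWeakHyperation f g) (γ ξ : Ordinal.{u}) :
    Ordinal.veblenWith f γ ξ ≤ g (ω ^ γ) ξ := by
  induction γ using WellFoundedLT.induction generalizing ξ with
  | ind γ ih =>
    by_cases h : γ = 0
    · rw [h, Ordinal.opow_zero, hg.one, Ordinal.veblenWith_zero]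
    have hrange : ∀ η, ∃ ζ, Ordinal.veblenWith f γ ζ = g (ω ^ γ) η := by
      intro η
      refine (Ordinal.mem_range_veblenWith hf h).2 fun δ hδ => ?_
      refine le_antisymm ?_ (Ordinal.right_le_veblenWith hf _ _)
      refine (ih δ hδ _).trans_eq ?_
      have h1 := congrFun (hg.add (ω ^ δ) (ω ^ γ)) η
      rw [Ordinal.add_omega0_opow
        ((Ordinal.opow_lt_opow_iff_right Ordinal.one_lt_omega0).2 hδ)] at h1
      exact h1.symm
    choose s hs using hrange
    have hmono : StrictMono s := fun a b hab => by
      have := (hg.normal (ω ^ γ)).strictMono hab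
      rwa [← hs, ← hs, Ordinal.veblenWith_lt_veblenWith_iff_right hf] at this
    rw [← hs, Ordinal.veblenWith_le_veblenWith_iff_right hf]
    exact hmono.le_apply

theorem isHyperation_hyper (hf : Order.IsNormal f) : IsHyperation f (hyper f) := by
  refine ⟨isWeakHyperation_hyper hf, fun g hg α => ?_⟩
  induction α using cnf_induction with
  | zero => intro ξ; rw [hyper_zero, hg.zero]
  | add γ β ih =>
    intro ξ
    rw [hyper_opow_add hf, hg.add]
    exact ((Ordinal.isNormal_veblenWith hf γ).monotone (ih ξ)).trans (hg.veblenWith_le hf γ _)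

theorem IsHyperation.eq_hyper (hf : Order.IsNormal f)
    {g : Ordinal.{u} → Ordinal.{u} → Ordinal.{u}} (hg : IsHyperation f g) : g = hyper f := by
  funext α ξ
  exact le_antisymm (hg.2 _ (isWeakHyperation_hyper hf) α ξ) ((isHyperation_hyper hf).2 g hg.1 α ξ)

theorem hyper_apply_zero (hf : Order.IsNormal f) (h0 : f 0 = 0) (β : Ordinal.{u}) :
    hyper f β 0 = 0 := by
  have hv : ∀ γ, Ordinal.veblenWith f γ 0 = 0 := by
    intro γ
    induction γ using WellFoundedLT.induction with
    | ind γ ih =>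
      by_cases h : γ = 0
      · rw [h, Ordinal.veblenWith_zero, h0]
      · obtain ⟨ζ, hζ⟩ := (Ordinal.mem_range_veblenWith hf h).2 ih
        exact le_antisymm
          (((Ordinal.isNormal_veblenWith hf γ).monotone (zero_le (a := ζ))).trans_eq hζ) zero_le
  induction β using cnf_induction with
  | zero => rw [hyper_zero]; rfl
  | add γ β ih => rw [hyper_opow_add hf, Function.comp_apply, ih, hv]

/-- A nonzero ordinal is not fixed by all Veblen functions over `f` when `1 < f 1`. -/
theorem exists_veblenWith_ne (hf : Order.IsNormal f) (h1 : 1 < f 1) {ξ : Ordinal.{u}}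
    (hξ : ξ ≠ 0) : ∃ γ, Ordinal.veblenWith f γ ξ ≠ ξ := by
  have hmono : StrictMono fun γ => Ordinal.veblenWith f γ 1 := by
    intro γ δ hγδ
    -- `veblenWith f δ 1` is a fixed point of `veblenWith f γ` and exceeds `1`, so it exceeds the
    -- value of `veblenWith f γ` at `1`.
    have hlt : 1 < Ordinal.veblenWith f δ 1 := by
      refine h1.trans_le ?_
      have := Ordinal.veblenWith_left_monotone hf 1 (zero_le (a := δ))
      simpa using this
    change Ordinal.veblenWith f γ 1 < Ordinal.veblenWith f δ 1
    rw [← Ordinal.veblenWith_veblenWith_of_lt hf hγδ]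
    exact (Ordinal.veblenWith_lt_veblenWith_iff_right hf).2 hlt
  refine ⟨ξ + 1, fun h => ?_⟩
  have h2 : ξ + 1 ≤ Ordinal.veblenWith f (ξ + 1) 1 := hmono.le_apply
  have h3 := (Ordinal.isNormal_veblenWith hf (ξ + 1)).monotone (Order.one_le_iff_pos.2
    (pos_iff_ne_zero.2 hξ))
  rw [h] at h3
  exact (Order.lt_add_one_iff.2 le_rfl).not_ge (h2.trans h3)

/-- A nonzero value of `f` is the value of some Veblen function over `f` at a smaller argument. -/
theorem exists_veblenWith_eq (hf : Order.IsNormal f) (h1 : 1 < f 1) {ξ : Ordinal.{u}}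
    (hξ : ξ ≠ 0) (hr : ξ ∈ Set.range f) : ∃ γ, ∃ η < ξ, Ordinal.veblenWith f γ η = ξ := by
  -- For the least `γ` whose Veblen function moves `ξ`, the smaller ones fix `ξ`.
  obtain ⟨γ, hγ, hmin⟩ := WellFounded.has_min (wellFounded_lt (α := Ordinal.{u}))
    {γ | Ordinal.veblenWith f γ ξ ≠ ξ} (exists_veblenWith_ne hf h1 hξ)
  have hr' : ξ ∈ Set.range (Ordinal.veblenWith f γ) := by
    by_cases h : γ = 0
    · rwa [h, Ordinal.veblenWith_zero]
    · exact (Ordinal.mem_range_veblenWith hf h).2 fun δ hδ => by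
        by_contra hne
        exact hmin δ hne hδ
  obtain ⟨η, hη⟩ := hr'
  refine ⟨γ, η, lt_of_le_of_ne ?_ ?_, hη⟩
  · exact (Ordinal.right_le_veblenWith hf γ η).trans_eq hη
  · rintro rfl
    exact hγ hη

end Hyper

/-! ### The ordinal of a worm -/

namespace Worm

/-- The least entry of a worm (and `0` for the empty worm). -/
noncomputable def lowest (w : Worm.{u}) : Ordinal.{u} := sInf {ξ | ξ ∈ w}

/-- The worm obtained by subtracting the least entry from all entries. -/
noncomputable def demote (w : Worm.{u}) : Worm.{u} := w.map (fun ξ => ξ - lowest w)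

theorem lowest_mem {w : Worm.{u}} (h : w ≠ []) : lowest w ∈ w :=
  csInf_mem (s := {ξ | ξ ∈ w}) (List.exists_mem_of_ne_nil w h)

theorem lowest_le {w : Worm.{u}} {ξ : Ordinal.{u}} (h : ξ ∈ w) : lowest w ≤ ξ :=
  csInf_le' (s := {ξ | ξ ∈ w}) h

theorem lowest_eq {w : Worm.{u}} {μ : Ordinal.{u}} (h : μ ∈ w) (h' : ∀ ξ ∈ w, μ ≤ ξ) :
    lowest w = μ :=
  le_antisymm (lowest_le h) (h' _ (lowest_mem (List.ne_nil_of_mem h)))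

theorem zero_mem_demote {w : Worm.{u}} (h : w ≠ []) : 0 ∈ demote w :=
  List.mem_map.2 ⟨lowest w, lowest_mem h, Ordinal.sub_self _⟩

theorem promote_map_sub {w : Worm.{u}} {μ : Ordinal.{u}} (h : ∀ ξ ∈ w, μ ≤ ξ) :
    promote μ (w.map fun ξ => ξ - μ) = w := by
  rw [promote, List.map_map]
  conv_rhs => rw [← List.map_id w]
  exact List.map_congr_left fun ξ hξ => Ordinal.add_sub_cancel_of_le (h ξ hξ)

theorem promote_demote (w : Worm.{u}) : promote (lowest w) (demote w) = w :=
  promote_map_sub fun _ => lowest_le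

theorem lowest_promote (α : Ordinal.{u}) {w : Worm.{u}} (h : w ≠ []) :
    lowest (promote α w) = α + lowest w := by
  refine lowest_eq (List.mem_map.2 ⟨_, lowest_mem h, rfl⟩) fun ξ hξ => ?_
  obtain ⟨η, hη, rfl⟩ := List.mem_map.1 hξ
  exact add_le_add_right (lowest_le hη) α

theorem demote_promote (α : Ordinal.{u}) (w : Worm.{u}) : demote (promote α w) = demote w := by
  by_cases h : w = []
  · rw [h]; rfl
  · rw [demote, lowest_promote α h, promote, List.map_map, demote]
    exact List.map_congr_left fun ξ _ => Ordinal.add_sub_add_cancel α ξ (lowest w)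

/-- The part of a worm before its first `0`. -/
noncomputable def zeroHead (w : Worm.{u}) : Worm.{u} := w.takeWhile (fun ξ => ξ ≠ 0)

/-- The part of a worm after its first `0`. -/
noncomputable def zeroRest (w : Worm.{u}) : Worm.{u} := (w.dropWhile (fun ξ => ξ ≠ 0)).tail

theorem zeroHead_append {v : Worm.{u}} (h : 0 ∉ v) (w : Worm.{u}) :
    zeroHead (v ++ 0 :: w) = v := by
  rw [zeroHead, List.takeWhile_append_of_pos]
  · simp
  · intro ξ hξ
    simpa using fun h0 : ξ = 0 => h (h0 ▸ hξ)

theorem zeroRest_append {v : Worm.{u}} (h : 0 ∉ v) (w : Worm.{u}) :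
    zeroRest (v ++ 0 :: w) = w := by
  rw [zeroRest, List.dropWhile_append_of_pos]
  · simp
  · intro ξ hξ
    simpa using fun h0 : ξ = 0 => h (h0 ▸ hξ)

theorem zeroHead_append_zeroRest {w : Worm.{u}} (h : 0 ∈ w) :
    zeroHead w ++ 0 :: zeroRest w = w := by
  obtain ⟨v, t, rfl, hv⟩ := List.eq_append_cons_of_mem h
  rw [zeroHead_append hv, zeroRest_append hv]

theorem length_zeroHead_add_length_zeroRest {w : Worm.{u}} (h : w ≠ []) :
    (zeroHead (demote w)).length + (zeroRest (demote w)).length + 1 = w.length := by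
  have h1 := congrArg List.length (zeroHead_append_zeroRest (zero_mem_demote h))
  rw [List.length_append, List.length_cons, demote, List.length_map, ← demote] at h1
  omega

/-- The ordinal of a worm, by recursion on its length: a nonempty worm is `μ ↑ (v 0 u)`, where `μ`
is its least entry and `0` does not occur in `v`, and it gets the ordinal `e ^ μ (o u + 1 + o v)`,
where `e` are the hyperexponentials. -/
noncomputable def wormOrd (w : Worm.{u}) : Ordinal.{u} :=
  if _h : w = [] then 0
  else hyper expFun (lowest w)
    (wormOrd (zeroRest (demote w)) + 1 + wormOrd (zeroHead (demote w)))
termination_by w.length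
decreasing_by
  all_goals
    have := length_zeroHead_add_length_zeroRest _h
    omega

theorem wormOrd_nil : wormOrd.{u} [] = 0 := by rw [wormOrd, dif_pos rfl]

theorem wormOrd_of_ne_nil {w : Worm.{u}} (h : w ≠ []) :
    wormOrd w = hyper expFun (lowest w)
      (wormOrd (zeroRest (demote w)) + 1 + wormOrd (zeroHead (demote w))) := by
  rw [wormOrd, dif_neg h]

theorem wormOrd_promote (α : Ordinal.{u}) (w : Worm.{u}) :
    wormOrd (promote α w) = hyper expFun α (wormOrd w) := by
  by_cases h : w = []
  · rw [h]
    exact wormOrd_nil.trans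
      (by rw [wormOrd_nil, hyper_apply_zero isNormal_expFun expFun_zero])
  · have h' : promote α w ≠ [] := by simpa [promote] using h
    rw [wormOrd_of_ne_nil h', demote_promote, lowest_promote α h, hyper_add isNormal_expFun,
      wormOrd_of_ne_nil h]
    rfl

theorem one_add_wormOrd_promote_one (w : Worm.{u}) :
    1 + wormOrd (promote 1 w) = ω ^ wormOrd w := by
  rw [wormOrd_promote, hyper_one, one_add_expFun]

theorem wormOrd_append_zero_of_notMem {v : Worm.{u}} (h : 0 ∉ v) (w : Worm.{u}) :
    wormOrd (v ++ 0 :: w) = wormOrd w + 1 + wormOrd v := by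
  have hl : lowest (v ++ 0 :: w) = 0 := lowest_eq (by simp) fun _ _ => zero_le
  have hd : demote (v ++ 0 :: w) = v ++ 0 :: w := by
    have := promote_demote (v ++ 0 :: w)
    rw [hl] at this
    simpa [promote] using this
  rw [wormOrd_of_ne_nil (by simp), hl, hd, zeroHead_append h, zeroRest_append h, hyper_zero]
  rfl

theorem wormOrd_append_zero (v w : Worm.{u}) :
    wormOrd (v ++ 0 :: w) = wormOrd w + 1 + wormOrd v := by
  induction hn : v.length using Nat.strong_induction_on generalizing v with
  | _ n ih =>
    by_cases h : (0 : Ordinal.{u}) ∈ v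
    · obtain ⟨a, b, rfl, ha⟩ := List.eq_append_cons_of_mem h
      rw [List.append_assoc, List.cons_append, wormOrd_append_zero_of_notMem ha,
        wormOrd_append_zero_of_notMem ha,
        ih b.length (by rw [← hn, List.length_append, List.length_cons]; omega) b rfl]
      simp only [add_assoc]
    · exact wormOrd_append_zero_of_notMem h w

/-- Every ordinal `ξ` is the ordinal of a worm. If `1 + ξ` is not additively principal, then
`ξ = a + 1 + b` with smaller `a` and `b`; otherwise `ξ` is in the range of `e`, and it is the value
of some hyperexponential at a smaller ordinal. -/
theorem wormOrd_surjective : Function.Surjective wormOrd.{u} := by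
  intro ξ
  induction ξ using WellFoundedLT.induction with
  | ind ξ ih =>
    by_cases h0 : ξ = 0
    · exact ⟨[], by rw [wormOrd_nil, h0]⟩
    by_cases hp : Ordinal.IsPrincipal (· + ·) (1 + ξ)
    · rcases Ordinal.isPrincipal_add_iff_zero_or_omega0_opow.1 hp with h | ⟨η, hη⟩
      · simp at h
      · have hr : ξ ∈ Set.range expFun :=
          ⟨η, add_left_cancel ((one_add_expFun η).trans hη)⟩
        obtain ⟨γ, ζ, hζ, rfl⟩ :=
          exists_veblenWith_eq isNormal_expFun one_lt_expFun_one h0 hr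
        obtain ⟨w, rfl⟩ := ih ζ hζ
        exact ⟨promote (ω ^ γ) w, by rw [wormOrd_promote, hyper_opow]⟩
    · obtain ⟨a, ha, b, hb, hab⟩ := Ordinal.exists_lt_add_of_not_isPrincipal_add hp
      -- A summand `0` is impossible, since the other one is less than `1 + ξ`.
      have ha0 : 1 ≤ a := by
        rw [Order.one_le_iff_pos, pos_iff_ne_zero]
        rintro rfl
        rw [zero_add] at hab
        exact hb.ne hab
      have hb0 : 1 ≤ b := by
        rw [Order.one_le_iff_pos, pos_iff_ne_zero]
        rintro rfl
        rw [add_zero] at hab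
        exact ha.ne hab
      rw [← Ordinal.add_sub_cancel_of_le ha0, add_lt_add_iff_left] at ha
      rw [← Ordinal.add_sub_cancel_of_le hb0, add_lt_add_iff_left] at hb
      obtain ⟨w, hw⟩ := ih _ ha
      obtain ⟨v, hv⟩ := ih _ hb
      refine ⟨v ++ 0 :: w, add_left_cancel (a := 1) ?_⟩
      rw [wormOrd_append_zero, hv, hw, ← hab, add_assoc, Ordinal.add_sub_cancel_of_le hb0,
        ← add_assoc, Ordinal.add_sub_cancel_of_le ha0]

end Worm

/-! ### The last exponent of the Cantor normal form -/

/-- Every nonzero `x` is `ω ^ e` times a successor, where `e` is the last exponent of its Cantor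
normal form. -/
theorem exists_eq_opow_mul_add_one {x : Ordinal.{u}} (hx : x ≠ 0) :
    ∃ e k : Ordinal.{u}, x = ω ^ e * (k + 1) := by
  induction x using cnf_induction with
  | zero => exact absurd rfl hx
  | add γ β ih =>
    by_cases hβ : β = 0
    · exact ⟨γ, 0, by simp [hβ]⟩
    obtain ⟨e, k, rfl⟩ := ih hβ
    rcases lt_or_ge γ e with h | h
    · refine ⟨e, k, Ordinal.add_of_omega0_opow_le
        ((Ordinal.opow_lt_opow_iff_right Ordinal.one_lt_omega0).2 h) ?_⟩
      exact Ordinal.le_mul_left _ (by simp)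
    · refine ⟨e, ω ^ (γ - e) + k, ?_⟩
      conv_lhs => rw [← Ordinal.add_sub_cancel_of_le h]
      rw [Ordinal.opow_add, ← mul_add, add_assoc]

theorem opow_dvd_opow_mul_add_one {d e k : Ordinal.{u}} :
    ω ^ d ∣ ω ^ e * (k + 1) ↔ d ≤ e := by
  refine ⟨fun h => ?_, fun h => (Ordinal.opow_dvd_opow ω h).mul_right _⟩
  by_contra hlt
  have h1 : ω ^ e * ω ∣ ω ^ e * (k + 1) := by
    rw [← Ordinal.opow_add_one]
    exact (Ordinal.opow_dvd_opow ω (Order.add_one_le_of_lt (not_le.1 hlt))).trans h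
  obtain ⟨c, hc⟩ := h1
  rw [mul_assoc] at hc
  have hpos : (0 : Ordinal.{u}) < ω ^ e := Ordinal.opow_pos e Ordinal.omega0_pos
  have h2 : k + 1 = ω * c := mul_left_cancel₀ hpos.ne' hc
  have h3 : (k + 1) % ω = 0 := by rw [h2, Ordinal.mul_mod]
  rw [← Ordinal.div_add_mod k ω, add_assoc, Ordinal.mul_add_mod_self,
    Ordinal.mod_eq_of_lt (Ordinal.isPrincipal_add_omega0 (Ordinal.mod_lt k Ordinal.omega0_ne_zero)
      Ordinal.one_lt_omega0)] at h3
  simp at h3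

open Classical in
/-- The last exponent of the Cantor normal form of `x`, with the value `0` at `x = 0`. -/
noncomputable def lastExp (x : Ordinal.{u}) : Ordinal.{u} :=
  if h : x ≠ 0 then (exists_eq_opow_mul_add_one h).choose else 0

theorem lastExp_zero : lastExp.{u} 0 = 0 := dif_neg (by simp)

theorem le_lastExp_iff {e x : Ordinal.{u}} (hx : x ≠ 0) : e ≤ lastExp x ↔ ω ^ e ∣ x := by
  have h : lastExp x = (exists_eq_opow_mul_add_one hx).choose := dif_pos hx
  obtain ⟨k, hk⟩ := (exists_eq_opow_mul_add_one hx).choose_spec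
  rw [← h] at hk
  conv_rhs => rw [hk]
  exact opow_dvd_opow_mul_add_one.symm

theorem lastExp_opow_mul_add_one (e k : Ordinal.{u}) : lastExp (ω ^ e * (k + 1)) = e := by
  have h0 : ω ^ e * (k + 1) ≠ 0 := mul_ne_zero (Ordinal.opow_pos e Ordinal.omega0_pos).ne' (by simp)
  refine le_antisymm ?_ ((le_lastExp_iff h0).2 (dvd_mul_right _ _))
  exact opow_dvd_opow_mul_add_one.1 ((le_lastExp_iff h0).1 le_rfl)

theorem lastExp_add_one (x : Ordinal.{u}) : lastExp (x + 1) = 0 := by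
  simpa using lastExp_opow_mul_add_one 0 x

/-- Among the ordinals `≥ a` with last exponent `≥ d` there is a least one, and its last exponent
is `d`, provided that `lastExp a ≤ d`. -/
theorem exists_least_lastExp {a d : Ordinal.{u}} (h : lastExp a ≤ d) :
    ∃ c, lastExp c = d ∧ a ≤ c ∧ ∀ y, a ≤ y → d ≤ lastExp y → c ≤ y := by
  rcases h.eq_or_lt with h | h
  · exact ⟨a, h, le_rfl, fun y hy _ => hy⟩
  have hpos : (0 : Ordinal.{u}) < ω ^ d := Ordinal.opow_pos d Ordinal.omega0_pos
  refine ⟨ω ^ d * (a / ω ^ d + 1), lastExp_opow_mul_add_one _ _,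
    (Ordinal.lt_mul_succ_div a hpos.ne').le, fun y hay hdy => ?_⟩
  have hy : y ≠ 0 := by
    rintro rfl
    rw [lastExp_zero] at hdy
    exact (h.trans_le hdy).not_ge zero_le
  have hlt : a < y := lt_of_le_of_ne hay (by rintro rfl; exact h.not_ge hdy)
  obtain ⟨k, rfl⟩ := (le_lastExp_iff hy).1 hdy
  refine mul_le_mul_right (Order.add_one_le_of_lt ?_) (ω ^ d)
  exact (Ordinal.lt_mul_iff_div_lt hpos.ne').1 hlt

/-! ### A universal model and irreflexivity -/

/-- Points of Ignatiev's model: each coordinate is at most the last exponent of the previous one. -/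
def IsIgnatievPoint (x : ℕ → Ordinal.{u}) : Prop := ∀ i, x (i + 1) ≤ lastExp (x i)

/-- `x` lies coordinatewise above the point `a, lastExp a, lastExp (lastExp a), …` of the main axis
of the model. -/
def AboveAxis (a : Ordinal.{u}) (x : ℕ → Ordinal.{u}) : Prop := ∀ i, lastExp^[i] a ≤ x i

theorem isIgnatievPoint_axis (a : Ordinal.{u}) : IsIgnatievPoint fun i => lastExp^[i] a :=
  fun i => (Function.iterate_succ_apply' lastExp i a).le

theorem aboveAxis_iff {a : Ordinal.{u}} {x : ℕ → Ordinal.{u}} :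
    AboveAxis a x ↔ a ≤ x 0 ∧ AboveAxis (lastExp a) fun i => x (i + 1) :=
  ⟨fun h => ⟨h 0, fun i => h (i + 1)⟩, fun h i => by
    cases i with
    | zero => exact h.1
    | succ i => exact h.2 i⟩

theorem iterate_lastExp_zero (i : ℕ) : lastExp^[i] (0 : Ordinal.{u}) = 0 :=
  Function.iterate_fixed lastExp_zero i

theorem aboveAxis_zero (x : ℕ → Ordinal.{u}) : AboveAxis 0 x := fun i => by
  rw [iterate_lastExp_zero]; exact zero_le

/-- A point `c', lastExp c', …` of the main axis whose first coordinate is large enough can be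
extended to the left, in the least way that puts an ordinal `≥ a` in front. -/
theorem exists_axis_lift {a c' : Ordinal.{u}} (h : lastExp a ≤ c') :
    ∃ c, lastExp c = c' ∧ a ≤ c ∧ ∀ x, IsIgnatievPoint x →
      (AboveAxis c x ↔ a ≤ x 0 ∧ AboveAxis c' fun i => x (i + 1)) := by
  obtain ⟨c, hc, hac, hmin⟩ := exists_least_lastExp h
  refine ⟨c, hc, hac, fun x hx => ?_⟩
  rw [aboveAxis_iff, hc]
  exact ⟨fun h => ⟨hac.trans h.1, h.2⟩, fun h => ⟨hmin _ h.1 ((h.2 0).trans (hx 0)), h.2⟩⟩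

/-- Two points of the main axis have a least common upper bound there. The bound `N` on the number
of nonzero coordinates allows for recursion from the last coordinate to the first. -/
theorem exists_axis_sup (N : ℕ) (a b : Ordinal.{u}) (ha : lastExp^[N] a = 0)
    (hb : lastExp^[N] b = 0) : ∃ c, lastExp^[N] c = 0 ∧ ∀ x, IsIgnatievPoint x →
      (AboveAxis c x ↔ AboveAxis a x ∧ AboveAxis b x) := by
  induction N generalizing a b with
  | zero =>
    obtain rfl : a = 0 := ha
    obtain rfl : b = 0 := hb
    exact ⟨0, rfl, fun x _ => (and_self_iff).symm⟩
  | succ N ih =>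
    wlog hba : b ≤ a generalizing a b
    · obtain ⟨c, hc, h⟩ := this b a hb ha (not_le.1 hba).le
      exact ⟨c, hc, fun x hx => (h x hx).trans and_comm⟩
    obtain ⟨c', hc', h'⟩ := ih (lastExp a) (lastExp b) ha hb
    have hle : lastExp a ≤ c' := 
      ((h' _ (isIgnatievPoint_axis c')).1 fun _ => le_rfl).1 0
    obtain ⟨c, rfl, hac, h⟩ := exists_axis_lift hle
    refine ⟨c, hc', fun x hx => ?_⟩
    rw [h x hx, h' _ fun i => hx (i + 1), aboveAxis_iff (a := a), aboveAxis_iff (a := b)]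
    exact ⟨fun h => ⟨⟨h.1, h.2.1⟩, hba.trans h.1, h.2.2⟩, fun h => ⟨h.1.1, h.1.2, h.2.2⟩⟩

/-- The points from which the modality of level `i` leads to a point above that of `a` again lie
above a single point of the main axis. -/
theorem exists_axis_dia (i : ℕ) (a : Ordinal.{u}) (ha : ∃ N, lastExp^[N] a = 0) :
    ∃ c, (∃ N, lastExp^[N] c = 0) ∧ ∀ x, IsIgnatievPoint x →
      (AboveAxis c x ↔ (∀ j < i, lastExp^[j] a ≤ x j) ∧ lastExp^[i] a < x i) := by
  induction i generalizing a with
  | zero =>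
    refine ⟨a + 1, ⟨1, lastExp_add_one a⟩, fun x _ => ?_⟩
    rw [aboveAxis_iff, lastExp_add_one]
    simp [aboveAxis_zero, Order.add_one_le_iff]
  | succ i ih =>
    obtain ⟨N, hN⟩ := ha
    obtain ⟨c', ⟨M, hM⟩, h'⟩ := ih (lastExp a) ⟨N, by
      rw [← Function.iterate_succ_apply, Function.iterate_succ_apply', hN, lastExp_zero]⟩
    have hle : lastExp a ≤ c' := by
      obtain ⟨h1, h2⟩ := (h' _ (isIgnatievPoint_axis c')).1 fun _ => le_rfl
      cases i with
      | zero => exact h2.le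
      | succ i => exact h1 0 (by omega)
    obtain ⟨c, rfl, hac, h⟩ := exists_axis_lift hle
    refine ⟨c, ⟨M + 1, hM⟩, fun x hx => ?_⟩
    rw [h x hx, h' _ fun i => hx (i + 1)]
    constructor
    · rintro ⟨h0, h1, h2⟩
      refine ⟨fun j hj => ?_, h2⟩
      cases j with
      | zero => exact h0
      | succ j => exact h1 j (by omega)
    · rintro ⟨h1, h2⟩
      exact ⟨h1 0 (by omega), fun j hj => h1 (j + 1) (by omega), h2⟩

namespace RCFormula

/-- Truth of a formula at a point of Ignatiev's model. The modality `λ` is read at level `r λ`: it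
leads to the points that agree below this level and are smaller at it. -/
def Forces (r : Ordinal.{u} → ℕ) : RCFormula.{u} → (ℕ → Ordinal.{u}) → Prop
  | top, _ => True
  | and φ ψ, x => Forces r φ x ∧ Forces r ψ x
  | dia lam φ, x => ∃ y, IsIgnatievPoint y ∧ (∀ j < r lam, y j = x j) ∧ y (r lam) < x (r lam) ∧
      Forces r φ y

theorem forces_dia_iff {r : Ordinal.{u} → ℕ} {φ : RCFormula.{u}} {a : Ordinal.{u}}
    (h : ∀ x, IsIgnatievPoint x → (Forces r φ x ↔ AboveAxis a x)) (lam : Ordinal.{u})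
    {x : ℕ → Ordinal.{u}} (hx : IsIgnatievPoint x) :
    Forces r (dia lam φ) x ↔
      (∀ j < r lam, lastExp^[j] a ≤ x j) ∧ lastExp^[r lam] a < x (r lam) := by
  constructor
  · rintro ⟨y, hy, hyx, hlt, hφ⟩
    have hay := (h y hy).1 hφ
    exact ⟨fun j hj => (hay j).trans_eq (hyx j hj), (hay _).trans_lt hlt⟩
  · rintro ⟨h1, h2⟩
    -- The witness follows `x` below the level of the modality, and the main axis from there on.
    have hy : IsIgnatievPoint fun j => if j < r lam then x j else lastExp^[j] a := by
      intro j
      dsimp only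
      by_cases hj : j + 1 < r lam
      · rw [if_pos hj, if_pos (by omega)]
        exact hx j
      · rw [if_neg hj]
        by_cases hj' : j < r lam
        · rw [if_pos hj']
          obtain heq | hne := eq_or_ne (j + 1) (r lam)
          · refine le_trans ?_ (hx j)
            rw [heq]
            exact h2.le
          · omega
        · rw [if_neg hj']
          exact isIgnatievPoint_axis a j
    refine ⟨_, hy, fun j hj => if_pos hj, by simpa using h2, (h _ hy).2 fun j => ?_⟩
    by_cases hj : j < r lam
    · exact (h1 j hj).trans_eq (if_pos hj).symm
    · exact (if_neg hj).ge

/-- The truth set of each formula is generated by a point of the main axis. -/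
theorem exists_forces_iff_aboveAxis (r : Ordinal.{u} → ℕ) (φ : RCFormula.{u}) :
    ∃ a, (∃ N, lastExp^[N] a = 0) ∧
      ∀ x, IsIgnatievPoint x → (Forces r φ x ↔ AboveAxis a x) := by
  induction φ with
  | top => exact ⟨0, ⟨0, rfl⟩, fun x _ => ⟨fun _ => aboveAxis_zero x, fun _ => trivial⟩⟩
  | and φ ψ ihφ ihψ =>
    obtain ⟨a, ⟨N, ha⟩, hφ⟩ := ihφ
    obtain ⟨b, ⟨M, hb⟩, hψ⟩ := ihψ
    obtain ⟨c, hc, h⟩ := exists_axis_sup (N + M) a b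
      (by rw [add_comm, Function.iterate_add_apply, ha, iterate_lastExp_zero])
      (by rw [Function.iterate_add_apply, hb, iterate_lastExp_zero])
    exact ⟨c, ⟨_, hc⟩, fun x hx =>
      (and_congr (hφ x hx) (hψ x hx)).trans (h x hx).symm⟩
  | dia lam φ ih =>
    obtain ⟨a, ha, hφ⟩ := ih
    obtain ⟨c, hc, h⟩ := exists_axis_dia (r lam) a ha
    exact ⟨c, hc, fun x hx => (forces_dia_iff hφ lam hx).trans (h x hx).symm⟩

/-- The axiom `λφ ⇒ μφ` for `μ ≤ λ` holds in the model although the relation for `λ` is not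
contained in that for `μ`: a point strictly above a point of the main axis at some level is strictly
above it at all earlier levels, so that the axis point itself is a witness. -/
theorem Forces.dia_lower {r : Ordinal.{u} → ℕ} {mu lam : Ordinal.{u}} (hr : r mu ≤ r lam)
    {φ : RCFormula.{u}} {x : ℕ → Ordinal.{u}} (hx : IsIgnatievPoint x)
    (h : Forces r (dia lam φ) x) : Forces r (dia mu φ) x := by
  obtain ⟨a, -, ha⟩ := exists_forces_iff_aboveAxis r φ
  rw [forces_dia_iff ha _ hx] at h ⊢
  refine Nat.decreasingInduction'
    (P := fun n => (∀ j < n, lastExp^[j] a ≤ x j) ∧ lastExp^[n] a < x n) ?_ hr h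
  rintro n - - ⟨h1, h2⟩
  refine ⟨fun j hj => h1 j (by omega), lt_of_le_of_ne (h1 n (by omega)) fun heq => ?_⟩
  rw [Function.iterate_succ_apply', heq] at h2
  exact h2.not_ge (hx n)

/-- Soundness of the model. A derivation only compares finitely many ordinals, so levels in `ℕ`
suffice if they keep these apart. -/
theorem Derives.sound {φ ψ : RCFormula.{u}} (h : Derives φ ψ) :
    ∃ S : Finset Ordinal.{u}, ∀ r : Ordinal.{u} → ℕ, Monotone r → StrictMonoOn r S →
      ∀ x, IsIgnatievPoint x → Forces r φ x → Forces r ψ x := by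
  classical
  induction h with
  | refl φ => exact ⟨∅, fun r _ _ x _ h => h⟩
  | toTop φ => exact ⟨∅, fun r _ _ x _ _ => trivial⟩
  | trans _ _ ih₁ ih₂ =>
    obtain ⟨S, hS⟩ := ih₁
    obtain ⟨T, hT⟩ := ih₂
    refine ⟨S ∪ T, fun r hr hs x hx h => ?_⟩
    rw [Finset.coe_union] at hs
    exact hT r hr (hs.mono Set.subset_union_right) x hx
      (hS r hr (hs.mono Set.subset_union_left) x hx h)
  | andLeft φ ψ => exact ⟨∅, fun r _ _ x _ h => h.1⟩
  | andRight φ ψ => exact ⟨∅, fun r _ _ x _ h => h.2⟩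
  | andIntro _ _ ih₁ ih₂ =>
    obtain ⟨S, hS⟩ := ih₁
    obtain ⟨T, hT⟩ := ih₂
    refine ⟨S ∪ T, fun r hr hs x hx h => ?_⟩
    rw [Finset.coe_union] at hs
    exact ⟨hS r hr (hs.mono Set.subset_union_left) x hx h,
      hT r hr (hs.mono Set.subset_union_right) x hx h⟩
  | diaDia lam φ =>
    refine ⟨∅, fun r _ _ x _ h => ?_⟩
    obtain ⟨y, hy, hyx, hlt, z, hz, hzy, hlt', hφ⟩ := h
    exact ⟨z, hz, fun j hj => (hzy j hj).trans (hyx j hj), hlt'.trans hlt, hφ⟩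
  | diaMono lam _ ih =>
    obtain ⟨S, hS⟩ := ih
    refine ⟨S, fun r hr hs x _ h => ?_⟩
    obtain ⟨y, hy, hyx, hlt, hφ⟩ := h
    exact ⟨y, hy, hyx, hlt, hS r hr hs y hy hφ⟩
  | diaLower φ hle => exact ⟨∅, fun r hr _ x hx h => h.dia_lower (hr hle) hx⟩
  | @diaAnd mu lam φ ψ hlt =>
    refine ⟨{mu, lam}, fun r _ hs x _ h => ?_⟩
    have hr : r mu < r lam := hs (by simp) (by simp) hlt
    obtain ⟨⟨y, hy, hyx, hylt, hφ⟩, z, hz, hzx, hzlt, hψ⟩ := h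
    refine ⟨y, hy, hyx, hylt, hφ, z, hz, fun j hj => ?_, ?_, hψ⟩
    · rw [hzx j hj, hyx j (hj.trans hr)]
    · rwa [hyx _ hr]

/-- Irreflexivity: the least point at which `φ` is true leads to no other such point. -/
theorem not_derives_dia_self (lam : Ordinal.{u}) (φ : RCFormula.{u}) :
    ¬ Derives φ (dia lam φ) := by
  classical
  intro h
  obtain ⟨S, hS⟩ := h.sound
  -- The level of `ξ` is the number of elements of `S` below it.
  have hmono : Monotone fun ξ => (S.filter (· < ξ)).card := fun a b hab =>
    Finset.card_le_card fun ξ hξ => by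
      rw [Finset.mem_filter] at hξ ⊢
      exact ⟨hξ.1, hξ.2.trans_le hab⟩
  have hstrict : StrictMonoOn (fun ξ => (S.filter (· < ξ)).card) (S : Set Ordinal.{u}) := by
    intro a ha b _ hab
    refine Finset.card_lt_card (Finset.ssubset_iff_subset_ne.2 ⟨fun ξ hξ => ?_, fun heq => ?_⟩)
    · rw [Finset.mem_filter] at hξ ⊢
      exact ⟨hξ.1, hξ.2.trans hab⟩
    · have : a ∈ S.filter (· < b) := Finset.mem_filter.2 ⟨ha, hab⟩
      rw [← heq, Finset.mem_filter] at this
      exact lt_irrefl a this.2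
  obtain ⟨a, -, ha⟩ := exists_forces_iff_aboveAxis (fun ξ => (S.filter (· < ξ)).card) φ
  have hpt := isIgnatievPoint_axis a
  obtain ⟨y, hy, -, hlt, hφ⟩ := hS _ hmono hstrict _ hpt ((ha _ hpt).2 fun _ => le_rfl)
  exact ((ha y hy).1 hφ _).not_gt hlt

end RCFormula

/-! ### Derivations between worms -/

namespace RCFormula

theorem promote_derives (α : Ordinal.{u}) {φ ψ : RCFormula.{u}} (h : Derives φ ψ) :
    Derives (promote α φ) (promote α ψ) := by
  induction h with
  | refl φ => exact .refl _
  | toTop φ => exact .toTop _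
  | trans _ _ ih₁ ih₂ => exact ih₁.trans ih₂
  | andLeft φ ψ => exact .andLeft _ _
  | andRight φ ψ => exact .andRight _ _
  | andIntro _ _ ih₁ ih₂ => exact .andIntro ih₁ ih₂
  | diaDia lam φ => exact .diaDia _ _
  | diaMono lam _ ih => exact .diaMono _ ih
  | diaLower φ hle => exact .diaLower _ (add_le_add_right hle α)
  | diaAnd φ ψ hlt => exact .diaAnd _ _ ((add_lt_add_iff_left α).2 hlt)

end RCFormula

namespace Worm

open RCFormula

theorem ConsLT.trans {mu : Ordinal.{u}} {v w x : Worm.{u}} (h : ConsLT mu v w)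
    (h' : ConsLT mu w x) : ConsLT mu v x :=
  Derives.trans h' ((Derives.diaMono mu h).trans (.diaDia _ _))

theorem ConsLT.promote (α : Ordinal.{u}) {v w : Worm.{u}} (h : ConsLT 0 v w) :
    ConsLT α (promote α v) (promote α w) := by
  have := promote_derives α (show Derives (toFormula w) (.dia 0 (toFormula v)) from h)
  rw [ConsLT, toFormula_promote, toFormula_promote]
  simpa only [RCFormula.promote, add_zero] using this

theorem not_consLT_self (mu : Ordinal.{u}) (w : Worm.{u}) : ¬ ConsLT mu w w :=
  not_derives_dia_self mu _

/-- If `0` does not occur in `v`, then `v 0 w` is equivalent to the conjunction of `v` and `0 w`. -/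
theorem toFormula_append_zero_equivalent {v : Worm.{u}} (h : 0 ∉ v) (w : Worm.{u}) :
    Equivalent (toFormula (v ++ 0 :: w)) (.and (toFormula v) (.dia 0 (toFormula w))) := by
  induction v with
  | nil => exact ⟨.andIntro (.toTop _) (.refl _), .andRight _ _⟩
  | cons lam v ih =>
    rw [List.mem_cons, not_or] at h
    have hpos : 0 < lam := pos_iff_ne_zero.2 (Ne.symm h.1)
    obtain ⟨h1, h2⟩ := ih h.2
    refine ⟨.andIntro (.diaMono _ (h1.trans (.andLeft _ _))) ?_,
      (Derives.diaAnd _ _ hpos).trans (.diaMono _ h2)⟩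
    exact (Derives.diaMono _ (h1.trans (.andRight _ _))).trans
      ((Derives.diaLower _ hpos.le).trans (.diaDia _ _))

theorem exists_promote_one_of_notMem {w : Worm.{u}} (h : 0 ∉ w) :
    ∃ v : Worm.{u}, w = promote 1 v :=
  ⟨w.map fun ξ => ξ - 1, (promote_map_sub fun ξ hξ => Order.one_le_iff_pos.2
    (pos_iff_ne_zero.2 (by rintro rfl; exact h hξ))).symm⟩

/-- `IsSplit w h φ R` says that `1 ↑ h` is the part of `w` before its first `0`, that the formula
`φ` stands for what follows (`⊤` if there is no `0`), and that `R` is the contribution of `φ` to the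
ordinal `1 + o w`. -/
def IsSplit (w h : Worm.{u}) (φ : RCFormula.{u}) (R : Ordinal.{u}) : Prop :=
  (w = promote 1 h ∧ φ = .top ∧ R = 0) ∨
    ∃ t, w = promote 1 h ++ 0 :: t ∧ φ = .dia 0 (toFormula t) ∧ R = 1 + wormOrd t

theorem exists_isSplit (w : Worm.{u}) : ∃ h φ R, IsSplit w h φ R := by
  by_cases h0 : (0 : Ordinal.{u}) ∈ w
  · obtain ⟨a, t, rfl, ha⟩ := List.eq_append_cons_of_mem h0
    obtain ⟨h, rfl⟩ := exists_promote_one_of_notMem ha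
    exact ⟨h, _, _, Or.inr ⟨t, rfl, rfl, rfl⟩⟩
  · obtain ⟨h, rfl⟩ := exists_promote_one_of_notMem h0
    exact ⟨h, _, _, Or.inl ⟨rfl, rfl, rfl⟩⟩

theorem zero_notMem_promote_one (h : Worm.{u}) : 0 ∉ promote 1 h := by
  simp [promote]

section IsSplit

variable {w h : Worm.{u}} {φ : RCFormula.{u}} {R : Ordinal.{u}}

theorem IsSplit.equivalent (hs : IsSplit w h φ R) :
    Equivalent (toFormula w) (.and (toFormula (promote 1 h)) φ) := by
  rcases hs with ⟨rfl, rfl, rfl⟩ | ⟨t, rfl, rfl, rfl⟩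
  · exact ⟨.andIntro (.refl _) (.toTop _), .andLeft _ _⟩
  · exact toFormula_append_zero_equivalent (zero_notMem_promote_one h) t

theorem IsSplit.one_add_wormOrd (hs : IsSplit w h φ R) : 1 + wormOrd w = R + ω ^ wormOrd h := by
  rw [← one_add_wormOrd_promote_one]
  rcases hs with ⟨rfl, rfl, rfl⟩ | ⟨t, rfl, rfl, rfl⟩
  · rw [zero_add]
  · rw [wormOrd_append_zero]
    simp only [add_assoc]

theorem IsSplit.length_le (hs : IsSplit w h φ R) : h.length ≤ w.length := by
  rcases hs with ⟨rfl, -⟩ | ⟨t, rfl, -⟩ <;> simp [promote]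

theorem IsSplit.length_lt (hs : IsSplit w h φ R) (h0 : 0 ∈ w) : h.length < w.length := by
  rcases hs with ⟨rfl, -⟩ | ⟨t, rfl, -⟩
  · exact absurd h0 (zero_notMem_promote_one h)
  · simp only [promote, List.length_append, List.length_map, List.length_cons]; omega

/-- If `φ` is `0 t`, then `⟨1⟩(1 ↑ h)` absorbs it by the axiom for conjunctions of diamonds, which
gives `⟨1⟩w`, and `⟨0⟩w` follows. -/
theorem IsSplit.derives_dia (hs : IsSplit w h φ R) :
    Derives (.and (.dia 1 (toFormula (promote 1 h))) φ) (.dia 0 (toFormula w)) := by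
  have key : Derives (.and (.dia 1 (toFormula (promote 1 h))) φ)
      (.dia 1 (.and (toFormula (promote 1 h)) φ)) := by
    rcases hs with ⟨-, rfl, -⟩ | ⟨t, -, rfl, -⟩
    · exact (Derives.andLeft _ _).trans (.diaMono _ (.andIntro (.refl _) (.toTop _)))
    · exact .diaAnd _ _ zero_lt_one
  exact key.trans ((Derives.diaMono 1 hs.equivalent.2).trans (.diaLower _ zero_le))

end IsSplit

/-- Larger ordinals give derivable consistency, and equal ordinals give derivability. -/
def Complete (v w : Worm.{u}) : Prop :=
  (wormOrd v < wormOrd w → ConsLT 0 v w) ∧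
    (wormOrd v = wormOrd w → Derives (toFormula w) (toFormula v))

/-- The induction step for completeness, for worms one of which contains `0`. With
`1 + o v = S + ω ^ o k` and `1 + o w = R + ω ^ o h`, the two last terms decide the comparison, unless
`o v` is bounded by the ordinal of the part of `w` after its first `0`. -/
theorem complete_of_zero_mem {v w : Worm.{u}} (h0 : 0 ∈ v ∨ 0 ∈ w)
    (ih : ∀ v' w' : Worm.{u}, v'.length + w'.length < v.length + w.length → Complete v' w') :
    Complete v w := by
  obtain ⟨h, φ, R, hw⟩ := exists_isSplit w
  obtain ⟨k, ψ, S, hv⟩ := exists_isSplit v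
  have hlen : k.length + h.length < v.length + w.length := by
    have h1 := hv.length_le
    have h2 := hw.length_le
    rcases h0 with h0 | h0
    · have := hv.length_lt h0; omega
    · have := hw.length_lt h0; omega
  have hwo := hw.one_add_wormOrd
  have hvo := hv.one_add_wormOrd
  have hwψ : wormOrd v ≤ wormOrd w → Derives (toFormula w) ψ := by
    intro hle
    rcases hv with ⟨-, rfl, -⟩ | ⟨s, hvs, rfl, rfl⟩
    · exact .toTop _
    · refine (ih s w ?_).1 (lt_of_lt_of_le ?_ hle)
      · rw [hvs, List.length_append, List.length_cons]; omega
      · rw [← add_lt_add_iff_left 1, hvo]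
        exact lt_add_of_pos_right _ (Ordinal.opow_pos _ Ordinal.omega0_pos)
  have hwh : Derives (toFormula w) (toFormula (promote 1 h)) :=
    hw.equivalent.1.trans (.andLeft _ _)
  constructor
  · intro hlt
    -- Either the last terms decide, or `v` already lies at or below the part of `w` after its
    -- first `0`.
    rcases lt_or_ge R (1 + wormOrd v) with hR | hR
    · have hkh : wormOrd k < wormOrd h := by
        refine lt_of_add_opow_lt_add_opow (a := R) (b := S) (hvo ▸ hR) ?_
        rw [← hvo, ← hwo]
        exact (add_lt_add_iff_left 1).2 hlt
      have h1 := ((ih k h hlen).1 hkh).promote 1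
      exact Derives.trans (.andIntro (hwh.trans h1) (hwψ hlt.le)) hv.derives_dia
    · rcases hw with ⟨-, -, rfl⟩ | ⟨t, hwt, rfl, rfl⟩
      · exact absurd (zero_lt_one.trans_le (le_self_add.trans hR)) (lt_irrefl _)
      · have htl : v.length + t.length < v.length + w.length := by
          rw [hwt, List.length_append, List.length_cons]; omega
        have hwt' : ConsLT 0 t w := by
          rw [hwt]
          exact (toFormula_append_zero_equivalent (zero_notMem_promote_one h) t).1.trans
            (.andRight _ _)
        rcases ((add_le_add_iff_left 1).1 hR).lt_or_eq with h1 | h1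
        · exact ((ih v t htl).1 h1).trans hwt'
        · exact Derives.trans hwt' (.diaMono 0 ((ih v t htl).2 h1))
  · intro heq
    have hkh : wormOrd k = wormOrd h := by
      refine eq_of_add_opow_eq_add_opow (a := S) (b := R) ?_
      rw [← hvo, ← hwo, heq]
    have h1 := promote_derives 1 ((ih k h hlen).2 hkh)
    rw [← toFormula_promote, ← toFormula_promote] at h1
    exact Derives.trans (.andIntro (hwh.trans h1) (hwψ heq.le)) hv.equivalent.2

/-- Two worms that are not both empty are promotions, by the same ordinal, of worms one of which
contains `0`. -/
theorem complete (v w : Worm.{u}) : Complete v w := by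
  induction hn : v.length + w.length using Nat.strong_induction_on generalizing v w with
  | _ n ih =>
    by_cases hnil : v ++ w = []
    · obtain ⟨rfl, rfl⟩ := List.append_eq_nil_iff.1 hnil
      exact ⟨fun h => absurd h (lt_irrefl _), fun _ => .refl _⟩
    obtain ⟨μ, hμ⟩ : ∃ μ, μ = lowest (v ++ w) := ⟨_, rfl⟩
    have hv := promote_map_sub (w := v) (μ := μ) fun ξ hξ =>
      hμ ▸ lowest_le (List.mem_append_left w hξ)
    have hw := promote_map_sub (w := w) (μ := μ) fun ξ hξ =>
      hμ ▸ lowest_le (List.mem_append_right v hξ)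
    have h0 : 0 ∈ v.map (fun ξ => ξ - μ) ∨ 0 ∈ w.map (fun ξ => ξ - μ) := by
      rw [← List.mem_append, ← List.map_append, hμ]
      exact zero_mem_demote hnil
    have hc : Complete (v.map fun ξ => ξ - μ) (w.map fun ξ => ξ - μ) :=
      complete_of_zero_mem h0 fun v' w' hlt => ih _
        (by rwa [← hn, ← List.length_map (as := v) (fun ξ => ξ - μ),
          ← List.length_map (as := w) (fun ξ => ξ - μ)]) v' w' rfl
    have hmono := (hyper_normal isNormal_expFun.{u} μ).strictMono
    rw [← hv, ← hw, Complete, wormOrd_promote, wormOrd_promote, hmono.lt_iff_lt,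
      hmono.injective.eq_iff]
    refine ⟨fun h => ?_, fun h => ?_⟩
    · exact Derives.trans ((hc.1 h).promote μ) (.diaLower _ zero_le)
    · rw [toFormula_promote, toFormula_promote]
      exact promote_derives μ (hc.2 h)

/-- The preorder of worms at level `0` is the order of their ordinals. Completeness gives one
direction; the other follows from it by irreflexivity. -/
theorem consLE_zero_iff {v w : Worm.{u}} : ConsLE 0 v w ↔ wormOrd v ≤ wormOrd w := by
  constructor
  · intro h
    by_contra hlt
    have hwv : ConsLT 0 w v := (complete w v).1 (not_le.1 hlt)
    rcases h with h | h
    · exact not_consLT_self 0 v (h.trans hwv)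
    · exact not_consLT_self 0 v (Derives.trans hwv (.diaMono 0 h.2))
  · intro h
    rcases h.lt_or_eq with h | h
    · exact Or.inl ((complete v w).1 h)
    · exact Or.inr ⟨(complete w v).2 h.symm, (complete v w).2 h⟩

end Worm

/-! ### The order-type function -/

theorem IsOrderTypeFunction.of_surjective {A : Type*} {le : A → A → Prop} {o : A → Ordinal.{u}}
    (hle : ∀ a b, le a b ↔ o a ≤ o b) (hs : Function.Surjective o) : IsOrderTypeFunction le o := by
  intro a
  constructor
  · rintro ξ ⟨b, -, h, rfl⟩
    rw [hle, not_le] at h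
    exact Order.add_one_le_of_lt h
  · intro c hc
    by_contra hlt
    obtain ⟨b, rfl⟩ := hs c
    rw [not_le] at hlt
    exact (Order.lt_add_one_iff.2 le_rfl).not_ge
      (hc ⟨b, (hle b a).2 hlt.le, fun h => ((hle a b).1 h).not_gt hlt, rfl⟩)

/-- A function that represents the preorder makes its strict part well-founded, which leaves only one
solution of the recursion for the order type. -/
theorem IsOrderTypeFunction.unique {A : Type*} {le : A → A → Prop} {o o' : A → Ordinal.{u}}
    (hle : ∀ a b, le a b ↔ o a ≤ o b) (h : IsOrderTypeFunction le o)
    (h' : IsOrderTypeFunction le o') : o' = o := by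
  funext a
  induction hξ : o a using WellFoundedLT.induction generalizing a with
  | ind ξ ih =>
    have hset : {ζ | ∃ b, le b a ∧ ¬ le a b ∧ ζ = o' b + 1} =
        {ζ | ∃ b, le b a ∧ ¬ le a b ∧ ζ = o b + 1} := by
      ext ζ
      refine exists_congr fun b => and_congr_right fun _ => and_congr_right fun hb => ?_
      rw [ih (o b) (by rwa [hle, not_le, hξ] at hb) b rfl]
    have h1 := h' a
    rw [hset] at h1
    exact (h1.unique (h a)).trans hξ

/-- The order-type function `o` of worms (with values in the ordinals of their entries) and the
hyperexponentials `e` exist and are unique, and they satisfy the calculus for `o`. -/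
theorem mainTheorem5 :
    (∃! o : Worm.{u} → Ordinal.{u}, IsOrderTypeFunction (Worm.ConsLE 0) o) ∧
    (∃! e : Ordinal.{u} → Ordinal.{u} → Ordinal.{u}, IsHyperation expFun e) ∧
    ∀ (o : Worm.{u} → Ordinal.{u}) (e : Ordinal.{u} → Ordinal.{u} → Ordinal.{u}),
      IsOrderTypeFunction (Worm.ConsLE 0) o → IsHyperation expFun e →
      ∀ (v w : Worm.{u}) (α : Ordinal.{u}),
        o [] = 0 ∧
        o (v ++ 0 :: w) = o w + 1 + o v ∧
        o (Worm.promote α w) = e α (o w) := by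
  have hle : ∀ v w : Worm.{u}, Worm.ConsLE 0 v w ↔ Worm.wormOrd v ≤ Worm.wormOrd w :=
    fun _ _ => Worm.consLE_zero_iff
  have ho := IsOrderTypeFunction.of_surjective hle Worm.wormOrd_surjective
  refine ⟨⟨_, ho, fun o' h' => ho.unique hle h'⟩,
    ⟨_, isHyperation_hyper isNormal_expFun, fun e he => he.eq_hyper isNormal_expFun⟩, ?_⟩
  intro o e h he v w α
  rw [ho.unique hle h, he.eq_hyper isNormal_expFun]
  exact ⟨Worm.wormOrd_nil, Worm.wormOrd_append_zero v w, Worm.wormOrd_promote α w⟩
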